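/- A partial word over an alphabet $A$ is a finite or infinite word over $A\cup\{\diamond\}$, where $\diamond\notin A$ is called a hole; a full word is a partial word without holes. For finite partial words $u,v$ of the same length write $u\subset v$ if $u[i]=v[i]$ whenever $u[i]\neq\diamond$; $u$ and $v$ are compatible if there is a partial word $w$ with $u\subset w$ and $v\subset w$. A full square is a full word $xx$ with $x$ nonempty. Let $\psi:\{0,1,2,3,4\}^*\to\{0,1,2,3,4\}^*$ be the $24$-uniform morphism \begin{align*} \psi(0)&=012321012340121012321234, & \psi(1)&=012101234323401234321234,\\ \psi(2)&=012101232123401232101234, & \psi(3)&=012321234323401232101234,\\ \psi(4)&=012321234012101234321234, \end{align*} let $\psi^\omega(0)$ be the infinite word that has $\psi^n(0)$ as a prefix for every $n\ge 0$, and let $\phi:\{0,1,2,3,4\}^*\to\{0,1,\diamond\}^*$ be the morphism $$\phi(0)=\diamond 11100,\quad \phi(1)=101100,\quad \phi(2)=111000,\quad \phi(3)=110010,\quad \phi(4)=110001.$$ Then the set of full squares over $\{0,1\}$ that are compatible with some factor (contiguous finite block) of the infinite binary partial word $\phi(\psi^\omega(0))$ is exactly $\{00,\ 11,\ 0101,\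 1111\}$. -/

import Mathlib

namespace PartialWords

/-- A partial word over `α`: a finite word over `α` together with the hole `⋄`, written `none`. -/
abbrev PartialWord (α : Type*) := List (Option α)

/-- A full word viewed as a partial word without holes. -/
def ofFull {α : Type*} (w : List α) : PartialWord α := w.map some

/-- `u ⊂ v`: the words have the same length and `u[i] = v[i]` whenever `u[i]` is not a hole. -/
def Contained {α : Type*} (u v : PartialWord α) : Prop :=
  List.Forall₂ (fun a b => a ≠ none → a = b) u v

/-- `u ↑ v`: both `u` and `v` are contained in a common partial word. -/
def Compatible {α : Type*} (u v : PartialWord α) : Prop :=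
  ∃ w : PartialWord α, Contained u w ∧ Contained v w

/-- A (full) square: a word `xx` with `x` nonempty. -/
def IsFullSquare {α : Type*} (s : List α) : Prop :=
  ∃ x : List α, x ≠ [] ∧ s = x ++ x

/-- The factor of length `n` of the infinite word `w` that starts at position `j`. -/
def factor {α : Type*} (w : ℕ → α) (j n : ℕ) : List α :=
  (List.range n).map fun i => w (j + i)

/-- The morphism of free monoids of words that is given by the images `f` of the letters. -/
def morphism {α β : Type*} (f : α → List β) (w : List α) : List β := w.flatMap f

/-- The infinite word `f^ω(a)`: the letter at position `n` is the letter at position `n` of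
`f^n(a)`. This is the limit of the words `f^n(a)` when `f(a)` begins with `a` and, as for the
uniform morphism below, `f^n(a)` is longer than `n` (`a` is used as a dummy value otherwise). -/
def omegaPower {α : Type*} (f : α → List α) (a : α) (n : ℕ) : α :=
  ((morphism f)^[n] [a]).getD n a

/-- The image of an infinite word `w` under a morphism without empty images of letters: the
letter at position `n` is found in the image of the prefix of `w` of length `n + 1`
(`d` is a dummy value). -/
def imageInf {α β : Type*} (f : α → List β) (d : β) (w : ℕ → α) (n : ℕ) : β :=
  (morphism f (factor w 0 (n + 1))).getD n d

/-- The 24-uniform morphism `ψ` on the letters `0, 1, 2, 3, 4`. -/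
def psi : Fin 5 → List (Fin 5)
  | 0 => [0,1,2,3,2,1,0,1,2,3,4,0,1,2,1,0,1,2,3,2,1,2,3,4]
  | 1 => [0,1,2,1,0,1,2,3,4,3,2,3,4,0,1,2,3,4,3,2,1,2,3,4]
  | 2 => [0,1,2,1,0,1,2,3,2,1,2,3,4,0,1,2,3,2,1,0,1,2,3,4]
  | 3 => [0,1,2,3,2,1,2,3,4,3,2,3,4,0,1,2,3,2,1,0,1,2,3,4]
  | 4 => [0,1,2,3,2,1,2,3,4,0,1,2,1,0,1,2,3,4,3,2,1,2,3,4]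

/-- The 6-uniform morphism `φ` from words on `0, 1, 2, 3, 4` to binary partial words. -/
def phi : Fin 5 → PartialWord (Fin 2)
  | 0 => [none, some 1, some 1, some 1, some 0, some 0]
  | 1 => [some 1, some 0, some 1, some 1, some 0, some 0]
  | 2 => [some 1, some 1, some 1, some 0, some 0, some 0]
  | 3 => [some 1, some 1, some 0, some 0, some 1, some 0]
  | 4 => [some 1, some 1, some 0, some 0, some 0, some 1]

/-- The infinite word `ψ^ω(0)`. -/
def psiOmega : ℕ → Fin 5 := omegaPower psi 0

/-- The infinite binary partial word `φ(ψ^ω(0))`. -/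
def phiPsiOmega : ℕ → Option (Fin 2) := imageInf phi none psiOmega

/-! Well-definedness: `ψ^n(0)` is a prefix of `psiOmega` for every `n`, and the `φ`-image of
every prefix of `psiOmega` is a prefix of `phiPsiOmega`. -/

theorem length_morphism {α β : Type*} {f : α → List β} {k : ℕ} (hf : ∀ a, (f a).length = k)
    (w : List α) : (morphism f w).length = k * w.length := by
  induction w with
  | nil => simp [morphism]
  | cons a w ih =>
    simp only [morphism, List.flatMap_cons, List.length_append, List.length_cons, hf] at ih ⊢
    rw [ih]; ring

theorem length_psi (a : Fin 5) : (psi a).length = 24 := by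
  fin_cases a <;> rfl

theorem length_phi (a : Fin 5) : (phi a).length = 6 := by
  fin_cases a <;> rfl

theorem length_psi_iterate (n : ℕ) : ((morphism psi)^[n] [0]).length = 24 ^ n := by
  induction n with
  | zero => rfl
  | succ n ih => rw [Function.iterate_succ_apply', length_morphism length_psi, ih, pow_succ']

theorem morphism_prefix {α β : Type*} (f : α → List β) {u v : List α} (h : u <+: v) :
    morphism f u <+: morphism f v := by
  obtain ⟨t, rfl⟩ := h
  exact ⟨morphism f t, by simp [morphism]⟩

theorem psi_iterate_prefix_succ (n : ℕ) :
    (morphism psi)^[n] [0] <+: (morphism psi)^[n + 1] [0] := by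
  induction n with
  | zero => exact ⟨(psi 0).tail, rfl⟩
  | succ n ih =>
    rw [Function.iterate_succ_apply', Function.iterate_succ_apply' _ (n + 1)]
    exact morphism_prefix psi ih

theorem psi_iterate_prefix {m n : ℕ} (h : m ≤ n) :
    (morphism psi)^[m] [0] <+: (morphism psi)^[n] [0] := by
  induction n, h using Nat.le_induction with
  | base => exact List.prefix_rfl
  | succ n _ ih => exact ih.trans (psi_iterate_prefix_succ n)

theorem getElem?_factor {α : Type*} (w : ℕ → α) (j n i : ℕ) (h : i < n) :
    (factor w j n)[i]? = some (w (j + i)) := by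
  simp [factor, h]

theorem getElem?_of_prefix {α : Type*} {u v : List α} (h : u <+: v) {i : ℕ}
    (hi : i < u.length) : v[i]? = u[i]? := by
  obtain ⟨t, rfl⟩ := h
  exact List.getElem?_append_left hi

/-- The prefix of length `24 ^ n` of `psiOmega` is `ψ^n(0)`. -/
theorem psiOmega_prefix (n : ℕ) : factor psiOmega 0 (24 ^ n) = (morphism psi)^[n] [0] := by
  apply List.ext_getElem?
  intro i
  by_cases hi : i < 24 ^ n
  · rw [getElem?_factor _ _ _ _ hi, Nat.zero_add]
    have hl : i < ((morphism psi)^[i] [0]).length := by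
      rw [length_psi_iterate]; exact Nat.lt_pow_self (by norm_num)
    have hl' : i < ((morphism psi)^[n] [0]).length := by rwa [length_psi_iterate]
    have key : ((morphism psi)^[i] [0])[i]? = ((morphism psi)^[n] [0])[i]? := by
      rcases le_total i n with h | h
      · exact (getElem?_of_prefix (psi_iterate_prefix h) hl).symm
      · exact getElem?_of_prefix (psi_iterate_prefix h) hl'
    rw [← key, psiOmega, omegaPower, List.getD_eq_getElem?_getD, List.getElem?_eq_getElem hl]
    rfl
  · rw [List.getElem?_eq_none (by simpa [factor] using hi),
      List.getElem?_eq_none (by rw [length_psi_iterate]; omega)]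

/-- The prefix of length `6 * n` of `phiPsiOmega` is the `φ`-image of the prefix of length `n`
of `psiOmega`. -/
theorem phiPsiOmega_prefix (n : ℕ) :
    factor phiPsiOmega 0 (6 * n) = morphism phi (factor psiOmega 0 n) := by
  have hlen : ∀ m, (morphism phi (factor psiOmega 0 m)).length = 6 * m := fun m => by
    rw [length_morphism length_phi]; simp [factor]
  have hpre : ∀ {m k : ℕ}, m ≤ k →
      morphism phi (factor psiOmega 0 m) <+: morphism phi (factor psiOmega 0 k) := by
    intro m k h
    obtain ⟨d, rfl⟩ := Nat.exists_eq_add_of_le h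
    refine morphism_prefix phi ⟨factor psiOmega m d, ?_⟩
    simp [factor, List.range_add]
  apply List.ext_getElem?
  intro i
  by_cases hi : i < 6 * n
  · rw [getElem?_factor _ _ _ _ hi, Nat.zero_add]
    have hl : i < (morphism phi (factor psiOmega 0 (i + 1))).length := by rw [hlen]; omega
    have hl' : i < (morphism phi (factor psiOmega 0 n)).length := by rwa [hlen]
    have key : (morphism phi (factor psiOmega 0 (i + 1)))[i]? =
        (morphism phi (factor psiOmega 0 n))[i]? := by
      rcases le_total (i + 1) n with h | h
      · exact (getElem?_of_prefix (hpre h) hl).symm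
      · exact getElem?_of_prefix (hpre h) hl'
    rw [← key, phiPsiOmega, imageInf, List.getD_eq_getElem?_getD, List.getElem?_eq_getElem hl]
    rfl
  · rw [List.getElem?_eq_none (by simpa [factor] using hi),
      List.getElem?_eq_none (by rw [hlen]; omega)]

end PartialWords

/-! Only squares up to compatibility of period less than 3 survive in `phiPsiOmega`. The argument
lifts repetitions through the two uniform morphisms and leaves finite checks. `psiOmega` is
square-free by descent on the period (`psiOmega_squarefree`). Short squares are ruled out by
inspecting short factors. In a long square, synchronization forces the period to be a multiple of
24, so the square comes from a factor `A y B y C`, where `A, B` share an image suffix and `B, C` the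
complementary prefix. This forces `A = B` or `B = C`, hence a square of period 24 times smaller. The
same scheme for `phi`, with compatibility in place of equality, turns a square of period at least 3
into a square of `psiOmega` (`phiPsiOmega_square_period`). The hole allows one exception, `A = 1`
and `B = 0`, which produces the factor `11`. Periods 1 and 2 are settled by inspection. -/

namespace PartialWords

/-! ### Factors of infinite words and their images under uniform morphisms -/

section Factor

variable {α β : Type*}

theorem length_factor (w : ℕ → α) (j n : ℕ) : (factor w j n).length = n := by
  simp [factor]

theorem factor_add (w : ℕ → α) (j m n : ℕ) :
    factor w j (m + n) = factor w j m ++ factor w (j + m) n := by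
  simp [factor, List.range_add, Nat.add_assoc]

theorem factor_succ (w : ℕ → α) (j n : ℕ) :
    factor w j (n + 1) = w j :: factor w (j + 1) n := by
  rw [Nat.add_comm, factor_add]; rfl

theorem drop_factor (w : ℕ → α) {j r n : ℕ} (h : r ≤ n) :
    (factor w j n).drop r = factor w (j + r) (n - r) := by
  obtain ⟨m, rfl⟩ := Nat.exists_eq_add_of_le h
  rw [factor_add, List.drop_append_of_le_length (by rw [length_factor]),
    List.drop_of_length_le (by rw [length_factor])]
  simp

theorem take_factor (w : ℕ → α) {j r n : ℕ} (h : r ≤ n) :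
    (factor w j n).take r = factor w j r := by
  obtain ⟨m, rfl⟩ := Nat.exists_eq_add_of_le h
  rw [factor_add, List.take_append_of_le_length (by rw [length_factor]),
    List.take_of_length_le (by rw [length_factor])]

/-- The infinite word `W` is the concatenation of the images `f (w 0), f (w 1), …`, all of which
have length `k`. -/
def IsUniformImage (f : α → List β) (k : ℕ) (w : ℕ → α) (W : ℕ → β) : Prop :=
  ∀ n, factor W (k * n) k = f (w n)

theorem IsUniformImage.factor_eq {f : α → List β} {k : ℕ} {w : ℕ → α} {W : ℕ → β}
    (h : IsUniformImage f k w W) (j m : ℕ) :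
    factor W (k * j) (k * m) = morphism f (factor w j m) := by
  induction m generalizing j with
  | zero => rfl
  | succ m ih =>
    have h1 : k * (m + 1) = k + k * m := by ring
    have h2 : k * j + k = k * (j + 1) := by ring
    rw [h1, factor_add, h j, h2, ih, factor_succ]
    rfl

/-- Arbitrarily long prefixes suffice, since uniform lengths determine where each block is cut; for
`psi` only lengths `24 ^ n` are at hand. -/
theorem isUniformImage_of_prefix {f : α → List β} {k : ℕ} {w : ℕ → α} {W : ℕ → β}
    (hf : ∀ a, (f a).length = k)
    (h : ∀ n, ∃ m, n < m ∧ factor W 0 (k * m) = morphism f (factor w 0 m)) :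
    IsUniformImage f k w W := by
  intro n
  obtain ⟨m, hm, e⟩ := h n
  obtain ⟨d, rfl⟩ : ∃ d, m = n + (1 + d) := ⟨m - n - 1, by omega⟩
  have hl : k * (n + (1 + d)) = k * n + (k + k * d) := by ring
  have hm' : ∀ u v, morphism f (u ++ v) = morphism f u ++ morphism f v := by
    intro u v; simp [morphism]
  rw [hl, factor_add, factor_add, factor_add, factor_add, hm', hm'] at e
  have e1 := (List.append_inj e (by
    rw [length_factor, length_morphism hf, length_factor])).2
  have e2 := (List.append_inj e1 (by
    rw [length_factor, length_morphism hf, length_factor, Nat.mul_one])).1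
  simpa [factor, morphism] using e2

end Factor

/-! ### Letterwise comparison of words -/

section Agree

variable {α β : Type*}

/-- The first `n` letters of the two words are pairwise related by `R`. -/
def agree (R : β → β → Bool) : ℕ → List β → List β → Bool
  | 0, _, _ => true
  | n + 1, a :: x, b :: y => R a b && agree R n x y
  | _ + 1, _, _ => false

theorem agree_factor (R : β → β → Bool) (W V : ℕ → β) {n M N : ℕ} (i j : ℕ)
    (hM : n ≤ M) (hN : n ≤ N) :
    agree R n (factor W i M) (factor V j N) = true ↔
      ∀ t < n, R (W (i + t)) (V (j + t)) = true := by
  induction n generalizing i j M N with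
  | zero => simp [agree]
  | succ n ih =>
    obtain ⟨M, rfl⟩ := Nat.exists_eq_add_of_le' (show 1 ≤ M by omega)
    obtain ⟨N, rfl⟩ := Nat.exists_eq_add_of_le' (show 1 ≤ N by omega)
    rw [factor_succ, factor_succ, agree, Bool.and_eq_true,
      ih (i + 1) (j + 1) (by omega) (by omega), Nat.forall_lt_succ_left]
    simp [Nat.add_assoc, Nat.add_comm 1]

/-- `W` contains a square up to `R`, of period `p`, starting at position `j`. -/
def SquareAt (R : β → β → Bool) (W : ℕ → β) (p j : ℕ) : Prop :=
  ∀ t < p, R (W (j + t)) (W (j + p + t)) = true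

theorem agree_image {f : α → List β} {k : ℕ} {w : ℕ → α} {W : ℕ → β}
    (h : IsUniformImage f k w W) (R : β → β → Bool) {a b r s m m' n : ℕ}
    (hr : r + n ≤ k * m) (hs : s + n ≤ k * m') :
    agree R n ((morphism f (factor w a m)).drop r) ((morphism f (factor w b m')).drop s) = true ↔
      ∀ t < n, R (W (k * a + r + t)) (W (k * b + s + t)) = true := by
  rw [← h.factor_eq, ← h.factor_eq, drop_factor _ (by omega), drop_factor _ (by omega)]
  exact agree_factor R W W _ _ (by omega) (by omega)

theorem agree_block {f : α → List β} {k : ℕ} {w : ℕ → α} {W : ℕ → β}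
    (h : IsUniformImage f k w W) (R : β → β → Bool) {a b r n : ℕ} (hr : r + n ≤ k) :
    agree R n ((f (w a)).drop r) ((f (w b)).drop r) = true ↔
      ∀ t < n, R (W (k * a + r + t)) (W (k * b + r + t)) = true := by
  rw [← h a, ← h b, drop_factor _ (by omega), drop_factor _ (by omega)]
  exact agree_factor R W W _ _ (by omega) (by omega)

/-- A square of `W` whose period is a multiple of `k` comes from `A y B y C` in `w`, where
`A, B` have related images from position `r` on and `B, C` have related images up to
position `r`. -/
theorem SquareAt.desubstitute {f : α → List β} {k : ℕ} {w : ℕ → α} {W : ℕ → β}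
    (h : IsUniformImage f k w W) {R : β → β → Bool} {q a r : ℕ} (hr : r < k) (hq : 0 < q)
    (hinj : ∀ A B, agree R k (f A) (f B) = true → A = B)
    (hsq : SquareAt R W (k * q) (k * a + r)) :
    (∀ t, 0 < t → t < q → w (a + t) = w (a + q + t)) ∧
      agree R (k - r) ((f (w a)).drop r) ((f (w (a + q))).drop r) = true ∧
      agree R r (f (w (a + q))) (f (w (a + 2 * q))) = true := by
  have hkq : k ≤ k * q := Nat.le_mul_of_pos_right k hq
  refine ⟨fun t ht0 htq => hinj _ _ ?_, ?_, ?_⟩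
  · have := agree_block h R (a := a + t) (b := a + q + t) (r := 0) (n := k) (by omega)
    rw [List.drop_zero, List.drop_zero] at this
    rw [this]
    intro s hs
    -- The first inner block begins `k - r` letters into the square, so block `t + 1` begins at
    -- offset `k * t + (k - r)`.
    obtain ⟨t, rfl⟩ : ∃ s, t = s + 1 := ⟨t - 1, by omega⟩
    have hlt : k * t + (k - r + s) < k * q := by
      obtain ⟨q', rfl⟩ : ∃ q', q = t + 2 + q' := ⟨q - (t + 2), by omega⟩
      have : k * (t + 2 + q') = k * t + 2 * k + k * q' := by ring
      omega
    convert hsq _ hlt using 2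
    · congr 1
      have : k * (a + (t + 1)) = k * a + k * t + k := by ring
      omega
    · congr 1
      have : k * (a + q + (t + 1)) = k * a + k * q + k * t + k := by ring
      omega
  · rw [agree_block h R (by omega)]
    intro s hs
    convert hsq s (by omega) using 3
    ring
  · have := agree_block h R (a := a + q) (b := a + 2 * q) (r := 0) (n := r) (by omega)
    rw [List.drop_zero, List.drop_zero] at this
    rw [this]
    intro s hs
    convert hsq (k * q - r + s) (by omega) using 2
    · congr 1
      have : k * (a + q) = k * a + k * q := by ring
      omega
    · congr 1
      have : k * (a + 2 * q) = k * a + k * q + k * q := by ring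
      omega

end Agree

/-! ### Factors of `psiOmega` -/

theorem psiOmega_isUniformImage : IsUniformImage psi 24 psiOmega psiOmega := by
  refine isUniformImage_of_prefix length_psi fun n => ⟨24 ^ n, Nat.lt_pow_self (by norm_num), ?_⟩
  rw [← pow_succ', psiOmega_prefix, psiOmega_prefix, Function.iterate_succ_apply']

theorem phiPsiOmega_isUniformImage : IsUniformImage phi 6 psiOmega phiPsiOmega :=
  isUniformImage_of_prefix length_phi fun n => ⟨n + 1, by omega, phiPsiOmega_prefix _⟩

/-- The factors of length `2` of `psiOmega`. -/
def psiPairs : List (List (Fin 5)) :=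
  [[0, 1], [1, 0], [1, 2], [2, 1], [2, 3], [3, 2], [3, 4], [4, 0], [4, 3]]

/-- The factors of length `k` of `psiOmega`, for `k ≤ 25`. -/
def psiFactors (k : ℕ) : List (List (Fin 5)) :=
  (psiPairs.flatMap fun u => (List.range 24).map fun r => ((morphism psi u).drop r).take k).dedup

theorem factor_psiOmega_of_pair {a r k : ℕ} (hr : r < 24) (hk : k ≤ 25) :
    factor psiOmega (24 * a + r) k = ((morphism psi (factor psiOmega a 2)).drop r).take k := by
  rw [← psiOmega_isUniformImage.factor_eq, drop_factor _ (by omega), take_factor _ (by omega)]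

/-- The list is closed under taking pairs in images, and the pair at `j` lies in the image of the
pair at `j / 24`, which is earlier unless `j = 0`. -/
theorem factor_two_mem_psiPairs (j : ℕ) : factor psiOmega j 2 ∈ psiPairs := by
  have key : ∀ u ∈ psiPairs, ∀ r < 24, ((morphism psi u).drop r).take 2 ∈ psiPairs := by
    decide +kernel
  induction j using Nat.strong_induction_on with
  | _ j ih =>
    rcases Nat.eq_zero_or_pos j with rfl | hj
    · have := psiOmega_prefix 1
      rw [pow_one] at this
      rw [← take_factor psiOmega (show 2 ≤ 24 by norm_num), this]
      decide +kernel
    · rw [← Nat.div_add_mod j 24, factor_psiOmega_of_pair (Nat.mod_lt _ (by norm_num)) (by norm_num)]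
      exact key _ (ih _ (Nat.div_lt_self hj (by norm_num))) _ (Nat.mod_lt _ (by norm_num))

theorem factor_mem_psiFactors (j : ℕ) {k : ℕ} (hk : k ≤ 25) :
    factor psiOmega j k ∈ psiFactors k := by
  have hr : j % 24 < 24 := Nat.mod_lt _ (by norm_num)
  rw [psiFactors, List.mem_dedup, List.mem_flatMap]
  refine ⟨_, factor_two_mem_psiPairs (j / 24), List.mem_map.2 ⟨j % 24, List.mem_range.2 hr, ?_⟩⟩
  rw [← factor_psiOmega_of_pair hr hk, Nat.div_add_mod]

/-! ### `psiOmega` is square-free -/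

/-- Equality of letters, as a Boolean relation. -/
def eqLetter (a b : Fin 5) : Bool := a.val == b.val

theorem eqLetter_iff {a b : Fin 5} : eqLetter a b = true ↔ a = b := by
  simp [eqLetter, Fin.ext_iff]

theorem psi_no_small_square : ∀ u ∈ psiFactors 4, ∀ r < 24, ∀ q < 36, q ≠ 0 →
    agree eqLetter q ((morphism psi u).drop r) ((morphism psi u).drop (r + q)) = false := by
  decide +kernel

theorem psi_synchronization : ∀ u ∈ psiFactors 3, ∀ v ∈ psiFactors 3, ∀ s < 4, ∀ r < 24,
    agree eqLetter 31 ((morphism psi u).drop (6 * s)) ((morphism psi v).drop r) = true →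
      r = 6 * s := by
  decide +kernel

/-- The longest prefix and the longest suffix that `psi B` shares with images of other letters are
too short to cover `psi B`. -/
theorem psi_agree_split : ∀ r < 24, ∀ A B C : Fin 5,
    agree eqLetter (24 - r) ((psi A).drop r) ((psi B).drop r) = true →
      agree eqLetter r (psi B) (psi C) = true → A = B ∨ B = C := by
  decide +kernel

theorem psi_agree_injective : ∀ A B : Fin 5,
    agree eqLetter 24 (psi A) (psi B) = true → A = B := by
  decide +kernel

theorem squareAt_of_inner_left {w : ℕ → Fin 5} {q a : ℕ}
    (h : ∀ t, 0 < t → t < q → w (a + t) = w (a + q + t)) (h0 : w a = w (a + q)) :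
    SquareAt eqLetter w q a := by
  intro t ht
  rw [eqLetter_iff]
  rcases Nat.eq_zero_or_pos t with rfl | ht0
  · exact h0
  · exact h t ht0 ht

theorem squareAt_of_inner_right {w : ℕ → Fin 5} {q a : ℕ}
    (h : ∀ t, 0 < t → t < q → w (a + t) = w (a + q + t)) (h1 : w (a + q) = w (a + 2 * q)) :
    SquareAt eqLetter w q (a + 1) := by
  intro t ht
  rw [eqLetter_iff]
  rcases Nat.lt_or_ge (t + 1) q with h' | h'
  · have := h (t + 1) (by omega) h'
    rwa [show a + 1 + t = a + (t + 1) by ring, show a + 1 + q + t = a + q + (t + 1) by ring]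
  · rwa [show a + 1 + t = a + q by omega, show a + 1 + q + t = a + 2 * q by omega]

theorem psiOmega_squarefree {q : ℕ} (hq : 0 < q) (j : ℕ) : ¬ SquareAt eqLetter psiOmega q j := by
  induction q using Nat.strong_induction_on generalizing j with
  | _ q ih =>
    intro hsq
    have hj := Nat.div_add_mod j 24
    have hr : j % 24 < 24 := Nat.mod_lt _ (by norm_num)
    generalize j / 24 = a at hj
    generalize j % 24 = r at hj hr
    subst hj
    rcases Nat.lt_or_ge q 36 with hq36 | hq36
    · have := psi_no_small_square _ (factor_mem_psiFactors a (by norm_num)) r hr q hq36 hq.ne'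
      rw [← Bool.not_eq_true, agree_image psiOmega_isUniformImage _ (by omega) (by omega)] at this
      exact this fun t ht => by simpa only [Nat.add_assoc] using hsq t ht
    -- Skipping at most 5 letters reaches a multiple of 6, and the window of 31 letters there fits
    -- in the first half because `5 + 31 = 36 ≤ q`.
    · obtain ⟨b, s, hs, d, hd, e⟩ : ∃ b s, s < 4 ∧ ∃ d, d < 6 ∧ 24 * a + r + d = 24 * b + 6 * s :=
        ⟨(24 * a + r + 5) / 24, (24 * a + r + 5) % 24 / 6, by omega,
          5 - (24 * a + r + 5) % 6, by omega, by omega⟩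
      have hsync := psi_synchronization _ (factor_mem_psiFactors b (by norm_num)) _
        (factor_mem_psiFactors ((24 * b + 6 * s + q) / 24) (by norm_num)) s hs
        ((24 * b + 6 * s + q) % 24) (Nat.mod_lt _ (by norm_num))
      rw [agree_image psiOmega_isUniformImage _ (by omega) (by omega), Nat.div_add_mod] at hsync
      have hmod := hsync fun t ht => by
        have := hsq (d + t) (by omega)
        rwa [show 24 * a + r + (d + t) = 24 * b + 6 * s + t by omega,
          show 24 * a + r + q + (d + t) = 24 * b + 6 * s + q + t by omega] at this
      obtain ⟨q, rfl⟩ : ∃ q', q = 24 * q' := ⟨q / 24, by omega⟩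
      obtain ⟨h1, h2, h3⟩ :=
        hsq.desubstitute psiOmega_isUniformImage hr (by omega) psi_agree_injective
      rcases psi_agree_split r hr _ _ _ h2 h3 with h | h
      · exact ih q (by omega) (by omega) _ (squareAt_of_inner_left h1 h)
      · exact ih q (by omega) (by omega) _ (squareAt_of_inner_right h1 h)

/-! ### Squares up to compatibility in `phiPsiOmega` -/

/-- Compatibility of letters of partial words. -/
def compatLetter : Option (Fin 2) → Option (Fin 2) → Bool
  | some a, some b => a.val == b.val
  | _, _ => true

theorem phi_no_medium_square : ∀ u ∈ psiFactors 7, ∀ r < 6, ∀ p < 19, 3 ≤ p →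
    agree compatLetter p ((morphism phi u).drop r) ((morphism phi u).drop (r + p)) = false := by
  decide +kernel

theorem phi_synchronization : ∀ u ∈ psiFactors 4, ∀ v ∈ psiFactors 4, ∀ s < 6, ∀ r < 6,
    agree compatLetter 19 ((morphism phi u).drop s) ((morphism phi v).drop r) = true →
      r = s := by
  decide +kernel

set_option synthInstance.maxSize 1000 in
-- The exception is due to the hole: `phi 1` and `phi 0` both end in `1100`, while the initial `⋄1`
-- of `phi 0` is compatible with the initial `11` of other images.
theorem phi_agree_split : ∀ r < 6, ∀ A B C : Fin 5,
    agree compatLetter (6 - r) ((phi A).drop r) ((phi B).drop r) = true →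
      agree compatLetter r (phi B) (phi C) = true → A = B ∨ B = C ∨ (A = 1 ∧ B = 0) := by
  decide +kernel

theorem phi_agree_injective : ∀ A B : Fin 5,
    agree compatLetter 6 (phi A) (phi B) = true → A = B := by
  decide +kernel

theorem psiOmega_succ_of_eq_zero {n : ℕ} (h : psiOmega n = 0) : psiOmega (n + 1) = 1 := by
  have key : ∀ b, [0, b] ∈ psiPairs → b = 1 := by decide
  apply key
  rw [← h]
  exact factor_two_mem_psiPairs n

theorem phiPsiOmega_square_period {p j : ℕ} (hsq : SquareAt compatLetter phiPsiOmega p j) :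
    p < 3 := by
  have hj := Nat.div_add_mod j 6
  have hr : j % 6 < 6 := Nat.mod_lt _ (by norm_num)
  generalize j / 6 = a at hj
  generalize j % 6 = r at hj hr
  subst hj
  by_contra hp
  rcases Nat.lt_or_ge p 19 with hp19 | hp19
  · have := phi_no_medium_square _ (factor_mem_psiFactors a (by norm_num)) r hr p hp19 (by omega)
    rw [← Bool.not_eq_true, agree_image phiPsiOmega_isUniformImage _ (by omega) (by omega)] at this
    exact this fun t ht => by simpa only [Nat.add_assoc] using hsq t ht
  · have hsync := phi_synchronization _ (factor_mem_psiFactors a (by norm_num)) _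
      (factor_mem_psiFactors ((6 * a + r + p) / 6) (by norm_num)) r hr
      ((6 * a + r + p) % 6) (Nat.mod_lt _ (by norm_num))
    rw [agree_image phiPsiOmega_isUniformImage _ (by omega) (by omega), Nat.div_add_mod] at hsync
    have hmod := hsync fun t ht => hsq t (by omega)
    obtain ⟨q, rfl⟩ : ∃ q, p = 6 * q := ⟨p / 6, by omega⟩
    obtain ⟨h1, h2, h3⟩ :=
      hsq.desubstitute phiPsiOmega_isUniformImage hr (by omega) phi_agree_injective
    rcases phi_agree_split r hr _ _ _ h2 h3 with h | h | ⟨hA, hB⟩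
    · exact psiOmega_squarefree (by omega) _ (squareAt_of_inner_left h1 h)
    · exact psiOmega_squarefree (by omega) _ (squareAt_of_inner_right h1 h)
    -- In `1 y 0 y C` the second `y` follows `0`, so `y` starts with `1`, and the initial `1 y`
    -- contains `11`. Here `y` is nonempty because `p ≥ 19`.
    · refine psiOmega_squarefree (q := 1) one_pos a fun t ht => ?_
      obtain rfl : t = 0 := by omega
      rw [eqLetter_iff]
      change psiOmega a = psiOmega (a + 1)
      rw [hA, h1 1 one_pos (by omega), psiOmega_succ_of_eq_zero hB]

/-! ### Full squares compatible with factors -/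

theorem compatible_iff_forall₂ {u v : PartialWord (Fin 2)} :
    Compatible u v ↔ List.Forall₂ (fun a b => compatLetter a b = true) u v := by
  constructor
  · rintro ⟨w, hu, hv⟩
    induction w generalizing u v with
    | nil => cases hu; cases hv; exact .nil
    | cons c w ih =>
      cases hu with
      | cons ha hu =>
        cases hv with
        | cons hb hv =>
          refine .cons ?_ (ih hu hv)
          rename_i a _ b _
          match a, b with
          | none, _ => rfl
          | some a, none => rfl
          | some a, some b =>
            have hab := (ha (by simp)).trans (hb (by simp)).symm
            simp only [Option.some.injEq] at hab
            simp [compatLetter, hab]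
  · intro h
    induction h with
    | nil => exact ⟨[], .nil, .nil⟩
    | @cons a b _ _ hab _ ih =>
      obtain ⟨w, hu, hv⟩ := ih
      refine ⟨(a <|> b) :: w, .cons ?_ hu, .cons ?_ hv⟩
      · cases a <;> simp
      · cases a <;> cases b <;> simp_all [compatLetter, Fin.ext_iff]

theorem compatible_factor_iff {s : List (Fin 2)} {W : ℕ → Option (Fin 2)} {j n : ℕ} :
    Compatible (ofFull s) (factor W j n) ↔
      s.length = n ∧ ∀ (t : ℕ) (ht : t < s.length), compatLetter (some s[t]) (W (j + t)) = true := by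
  rw [compatible_iff_forall₂, List.forall₂_iff_get]
  simp only [ofFull, List.length_map, length_factor]
  refine and_congr_right fun hn => ⟨fun h t ht => ?_, fun h t ht ht' => ?_⟩
  · simpa [factor] using h t ht (hn ▸ ht)
  · simpa [factor] using h t ht

/-- Compatibility is not transitive in general; it is when the middle letter is not a hole. -/
theorem compatLetter_trans_some {x : Fin 2} {a b : Option (Fin 2)}
    (ha : compatLetter (some x) a = true) (hb : compatLetter (some x) b = true) :
    compatLetter a b = true := by
  cases a <;> cases b <;> simp_all [compatLetter]

theorem squareAt_of_compatible {x : List (Fin 2)} {W : ℕ → Option (Fin 2)} {j n : ℕ}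
    (h : Compatible (ofFull (x ++ x)) (factor W j n)) :
    SquareAt compatLetter W x.length j := by
  obtain ⟨-, h⟩ := compatible_factor_iff.1 h
  intro t ht
  refine compatLetter_trans_some (x := x[t]) ?_ ?_
  · have := h t (by rw [List.length_append]; omega)
    rwa [List.getElem_append_left ht] at this
  · have := h (x.length + t) (by rw [List.length_append]; omega)
    rw [List.getElem_append_right (by omega)] at this
    simpa [Nat.add_assoc] using this

theorem agree_of_compatible_factor {s : List (Fin 2)} {a r n m : ℕ}
    (h : Compatible (ofFull s) (factor phiPsiOmega (6 * a + r) n)) (hr : r + s.length ≤ 6 * m) :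
    agree compatLetter s.length (ofFull s) ((morphism phi (factor psiOmega a m)).drop r) = true := by
  obtain ⟨-, h⟩ := compatible_factor_iff.1 h
  have e : ofFull s = factor (fun t => s[t]?) 0 s.length := by
    apply List.ext_getElem <;> simp [ofFull, factor]
  rw [← phiPsiOmega_isUniformImage.factor_eq, drop_factor _ (by omega), e,
    agree_factor _ _ _ _ _ le_rfl (by omega)]
  intro t ht
  simpa [ht] using h t ht

theorem compatible_factor_of_agree {s : List (Fin 2)} {a r m : ℕ} (hr : r + s.length ≤ 6 * m)
    (h : agree compatLetter s.length (ofFull s)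
      ((morphism phi (factor psiOmega a m)).drop r) = true) :
    Compatible (ofFull s) (factor phiPsiOmega (6 * a + r) s.length) := by
  have e : ofFull s = factor (fun t => s[t]?) 0 s.length := by
    apply List.ext_getElem <;> simp [ofFull, factor]
  rw [← phiPsiOmega_isUniformImage.factor_eq, drop_factor _ (by omega), e,
    agree_factor _ _ _ _ _ le_rfl (by omega)] at h
  refine compatible_factor_iff.2 ⟨rfl, fun t ht => ?_⟩
  simpa [ht] using h t ht

/-- This excludes `0000` and `1010`. -/
theorem phi_square_of_period_two : ∀ u ∈ psiFactors 2, ∀ r < 6, ∀ a b : Fin 2,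
    agree compatLetter 4 (ofFull [a, b, a, b]) ((morphism phi u).drop r) = true → b = 1 := by
  decide +kernel

theorem compatible_of_agree_psi_zero {s : List (Fin 2)} {r : ℕ} (hr : r + s.length ≤ 144)
    (h : agree compatLetter s.length (ofFull s) ((morphism phi (psi 0)).drop r) = true) :
    ∃ j n : ℕ, Compatible (ofFull s) (factor phiPsiOmega j n) := by
  refine ⟨6 * 0 + r, s.length, compatible_factor_of_agree (m := 24) hr ?_⟩
  have := psiOmega_prefix 1
  rw [pow_one] at this
  rw [this]
  simpa [morphism] using h

end PartialWords

open PartialWords in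
theorem mainTheorem3 :
    {s : List (Fin 2) | PartialWords.IsFullSquare s ∧
      ∃ j n : ℕ, PartialWords.Compatible (PartialWords.ofFull s)
        (PartialWords.factor PartialWords.phiPsiOmega j n)} =
    {[0, 0], [1, 1], [0, 1, 0, 1], [1, 1, 1, 1]} := by
  ext s
  simp only [Set.mem_ofPred_eq, Set.mem_insert_iff, Set.mem_singleton_iff]
  constructor
  · rintro ⟨⟨x, hx, rfl⟩, j, n, h⟩
    have hp := phiPsiOmega_square_period (squareAt_of_compatible h)
    match x, hx, hp, h with
    | [a], _, _, _ => fin_cases a <;> simp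
    | [a, b], _, _, h =>
      have hr : j % 6 < 6 := Nat.mod_lt _ (by norm_num)
      rw [← Nat.div_add_mod j 6] at h
      have hb := phi_square_of_period_two _ (factor_mem_psiFactors (j / 6) (by norm_num)) _ hr a b
        (agree_of_compatible_factor h (by simp; omega))
      subst hb
      fin_cases a <;> simp
    | _ :: _ :: _ :: _, _, hp, _ => simp at hp; omega
  · rintro (rfl | rfl | rfl | rfl)
    -- The four offsets are read off the prefix `⋄11100 101100`; `1111` uses the hole.
    · exact ⟨⟨[0], by simp, rfl⟩, compatible_of_agree_psi_zero (r := 4) (by decide) (by decide +kernel)⟩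
    · exact ⟨⟨[1], by simp, rfl⟩, compatible_of_agree_psi_zero (r := 1) (by decide) (by decide +kernel)⟩
    · exact ⟨⟨[0, 1], by simp, rfl⟩, compatible_of_agree_psi_zero (r := 5) (by decide) (by decide +kernel)⟩
    · exact ⟨⟨[1, 1], by simp, rfl⟩, compatible_of_agree_psi_zero (r := 0) (by decide) (by decide +kernel)⟩
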